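/- Let $V=\mathbb Q^6$. There exist a six-dimensional $\mathbb Q$-vector space $W\subset\wedge^2V^*$ of skew-symmetric bilinear forms on $V$ and a hyperplane $Z\subset W$, with coordinates $x_0,\dots,x_5$ on $W$ such that $Z=\{x_5=0\}$, for which the following holds. Let $\mathrm{Pf}$ denote the Pfaffian, a cubic form on $\wedge^2V^*$, and let $F\in\mathbb Q[x_0,\dots,x_5]$ and $f\in\mathbb Q[x_0,\dots,x_4]$ be its restrictions to $W$ and to $Z$. Let $Y=\{F=0\}\subset\mathbb P(W)\cong\mathbb P^5$ and $C=\{f=0\}\subset\mathbb P(Z)\cong\mathbb P^4$ be the corresponding Pfaffian cubic fourfold and Pfaffian cubic threefold, both defined over $\mathbb Q$. Then: 1. $F=x_5^3+f$; that is, $Y$ is the cyclic triple cover of $\mathbb P^4$ branched along $C$; 2. over $\mathbb C$, both $C$ and $Y$ are smooth (of dimension $3$ and $4$), and $Y$ contains no plane; 3. over $\mathbb C$, the surface $\Sigma=G(2,V)\cap\mathbb P(W^\circ)\subset\mathbb P(\wedge^2V)$ dual to $Y$ (known as the dual K3 surface of $Y$), where $G(2,V)$ is the Grassmannian in its Plücker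 embedding and $W^\circ\subset\wedge^2V$ is the nine-dimensional orthogonal space of $W$, is nonempty, smooth of pure dimension $2$, and contains no line. -/

import Mathlib

namespace PfaffianCubic

section Projective

variable {σ : Type*} {K : Type*} [Field K]

/-- `x : σ → K` is a common zero of the polynomials in `S`. For a set `S` of homogeneous
polynomials, the nonzero common zeros are the vectors representing the `K`-points of the closed
subscheme `V(S)` of the projective space with homogeneous coordinates indexed by `σ`. -/
def IsZero (S : Set (MvPolynomial σ K)) (x : σ → K) : Prop :=
  ∀ f ∈ S, MvPolynomial.eval x f = 0

/-- The gradient of the polynomial `f` at the point `x`. -/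
noncomputable def gradient (f : MvPolynomial σ K) (x : σ → K) : σ → K :=
  fun i => MvPolynomial.eval x (MvPolynomial.pderiv i f)

/-- For a set `S` of homogeneous polynomials over an algebraically closed field `K`, the
projective scheme `V(S)` is smooth of pure dimension `d` (Jacobian criterion): near each of its
points `x`, the ideal generated by `S` is generated by `c` elements whose gradients at `x` are
linearly independent, where `c` is the codimension, i.e. `c + d` is the dimension
`card σ - 1` of the ambient projective space. "Near `x`" means after inverting some
polynomial `h` with `h x ≠ 0`. -/
def IsSmoothOfDim [Fintype σ] (S : Set (MvPolynomial σ K)) (d : ℕ) : Prop :=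
  ∀ x : σ → K, x ≠ 0 → IsZero S x →
    ∃ (c : ℕ) (g : Fin c → MvPolynomial σ K) (h : MvPolynomial σ K),
      c + d + 1 = Fintype.card σ ∧
      (∀ j, g j ∈ Ideal.span S) ∧
      LinearIndependent K (fun j => gradient (g j) x) ∧
      MvPolynomial.eval x h ≠ 0 ∧
      ∀ f ∈ S, h * f ∈ Ideal.span (Set.range g)

/-- Over an algebraically closed field, the projective scheme `V(S)` contains a linear subspace of
dimension `d` of the ambient projective space (a line for `d = 1`, a plane for `d = 2`). -/
def ContainsLinearSubspace (S : Set (MvPolynomial σ K)) (d : ℕ) : Prop :=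
  ∃ L : Submodule K (σ → K), Module.finrank K L = d + 1 ∧ ∀ x ∈ L, IsZero S x

/-- Extension of scalars from `ℚ` to `ℂ` of a set of equations. -/
def complexify (S : Set (MvPolynomial σ ℚ)) : Set (MvPolynomial σ ℂ) :=
  MvPolynomial.map (algebraMap ℚ ℂ) '' S

/-- The cubic form `t ^ 3 + f(x₀, …, xₙ₋₁)`, where `t` is the last variable. For a cubic form `f`,
the hypersurface `t ^ 3 + f = 0` of `ℙⁿ`, with the projection that forgets `t`, is the
cyclic triple cover of `ℙⁿ⁻¹` branched along the cubic hypersurface `f = 0`. -/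
noncomputable def cyclicTripleCover {n : ℕ} (f : MvPolynomial (Fin n) K) :
    MvPolynomial (Fin (n + 1)) K :=
  MvPolynomial.X (Fin.last n) ^ 3 + MvPolynomial.rename Fin.castSucc f

end Projective

section Pfaffian

variable {R : Type*} [CommRing R]

/-- The Pfaffian of the `4 × 4` skew-symmetric submatrix of `A` on the rows and columns
`i, j, k, l`. -/
def pfaffian4 (A : Matrix (Fin 6) (Fin 6) R) (i j k l : Fin 6) : R :=
  A i j * A k l - A i k * A j l + A i l * A j k

/-- The Pfaffian of a `6 × 6` skew-symmetric matrix, by expansion along the first row. -/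
def pfaffian (A : Matrix (Fin 6) (Fin 6) R) : R :=
  A 0 1 * pfaffian4 A 2 3 4 5 - A 0 2 * pfaffian4 A 1 3 4 5 + A 0 3 * pfaffian4 A 1 2 4 5
    - A 0 4 * pfaffian4 A 1 2 3 5 + A 0 5 * pfaffian4 A 1 2 3 4

variable {K : Type*} [Field K]

/-- The cubic form `Pf (x₀ φ₀ + ⋯ + xₙ₋₁ φₙ₋₁)` in the variables `x₀, …, xₙ₋₁`. If
`φ₀, …, φₙ₋₁` is a basis of a space `W` of skew-symmetric forms, it is the equation, in the
corresponding coordinates of `ℙ(W)`, of the intersection of `ℙ(W)` with the Pfaffian locus of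
degenerate forms. -/
noncomputable def pfaffianForm {n : ℕ} (φ : Fin n → Matrix (Fin 6) (Fin 6) K) :
    MvPolynomial (Fin n) K :=
  pfaffian (Matrix.of fun i j => ∑ m, MvPolynomial.C (φ m i j) * MvPolynomial.X m)

end Pfaffian

section DualSurface

/-- The index set `{i < j}` of the Plücker coordinates on `⋀² V`, `V` of dimension `6`. -/
abbrev PluckerIndex : Type := {p : Fin 6 × Fin 6 // p.1 < p.2}

/-- The skew-symmetric matrix of a bivector with coordinates `a i j`, `i < j`. -/
def skewMatrix {R : Type*} [CommRing R] (a : PluckerIndex → R) : Matrix (Fin 6) (Fin 6) R :=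
  Matrix.of fun i j =>
    if h : i < j then a ⟨(i, j), h⟩ else if h : j < i then - a ⟨(j, i), h⟩ else 0

variable {K : Type*} [Field K]

/-- The Plücker quadrics `p i j * p k l - p i k * p j l + p i l * p j k`, which are the equations
of the Grassmannian `G(2, V)` of decomposable bivectors in `ℙ(⋀² V)`. -/
def pluckerQuadrics (K : Type*) [Field K] : Set (MvPolynomial PluckerIndex K) :=
  {f | ∃ i j k l : Fin 6, f = pfaffian4 (skewMatrix MvPolynomial.X) i j k l}

/-- The linear form on `⋀² V` given by the skew-symmetric bilinear form `φ` on `V`, that is,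
`u ∧ v ↦ φ(u, v)`. -/
noncomputable def linearForm (φ : Matrix (Fin 6) (Fin 6) K) : MvPolynomial PluckerIndex K :=
  ∑ p : PluckerIndex, MvPolynomial.C (φ p.1.1 p.1.2) * MvPolynomial.X p

/-- The equations in `ℙ(⋀² V)` of `G(2, V) ∩ ℙ(W°)`, where `W` is the span of the `φ m` in
`⋀² V*` and `W°` its orthogonal in `⋀² V`. -/
def dualEquations {n : ℕ} (φ : Fin n → Matrix (Fin 6) (Fin 6) K) :
    Set (MvPolynomial PluckerIndex K) :=
  pluckerQuadrics K ∪ Set.range fun m => linearForm (φ m)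

/-- The common zeros of the Plücker quadrics are exactly the decomposable bivectors. -/
theorem isZero_pluckerQuadrics_iff (a : PluckerIndex → K) :
    IsZero (pluckerQuadrics K) a ↔
      ∃ u v : Fin 6 → K, ∀ p, a p = u p.1.1 * v p.1.2 - u p.1.2 * v p.1.1 := by
  have key : ∀ i j, MvPolynomial.eval a (skewMatrix MvPolynomial.X i j) = skewMatrix a i j := by
    intro i j
    simp only [skewMatrix, Matrix.of_apply]
    split_ifs <;> simp
  have skew : ∀ i j, skewMatrix a j i = - skewMatrix a i j := by
    intro i j
    simp only [skewMatrix, Matrix.of_apply]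
    rcases lt_trichotomy i j with h | h | h
    · simp [h, h.not_gt]
    · simp [h]
    · simp [h, h.not_gt]
  have entry : ∀ p : PluckerIndex, skewMatrix a p.1.1 p.1.2 = a p := by
    intro p
    simp [skewMatrix, p.2]
  constructor
  · intro h
    have h' : ∀ i j k l, pfaffian4 (skewMatrix a) i j k l = 0 := by
      intro i j k l
      have := h _ ⟨i, j, k, l, rfl⟩
      simpa [pfaffian4, key] using this
    by_cases h0 : a = 0
    · exact ⟨0, 0, by simp [h0]⟩
    · obtain ⟨q, hq⟩ := Function.ne_iff.mp h0
      rw [← entry q] at hq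
      refine ⟨fun k => skewMatrix a q.1.1 k / skewMatrix a q.1.1 q.1.2,
        fun k => skewMatrix a q.1.2 k, fun p => ?_⟩
      have e := h' q.1.1 q.1.2 p.1.1 p.1.2
      simp only [pfaffian4] at e
      have hq' : skewMatrix a q.1.1 q.1.2 ≠ 0 := hq
      rw [← entry p]
      field_simp
      linear_combination e
  · rintro ⟨u, v, huv⟩ f ⟨i, j, k, l, rfl⟩
    have e : ∀ i j, skewMatrix a i j = u i * v j - u j * v i := by
      intro i j
      simp only [skewMatrix, Matrix.of_apply]
      split_ifs with h1 h2
      · exact huv _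
      · rw [huv]; ring
      · obtain rfl : i = j := le_antisymm (not_lt.mp h2) (not_lt.mp h1)
        ring
    simp only [pfaffian4, map_add, map_sub, map_mul, key, e]
    ring

end DualSurface

end PfaffianCubic

/-!
The example is the linear system of skew-symmetric forms `skewPencil x`, whose Pfaffian is
`x₅³ + f` with
`f = x₀³ + x₀x₁² - x₀x₂x₃ + x₁x₂² + x₂²x₄ - x₂x₄² + x₃²x₄`.
Here `x₅` multiplies the standard symplectic form `J`, and the forms in the hyperplane `Z` are those
with `x₅ = 0`. In the Pfaffian of `A + x₅ J` the coefficients of `x₅²` and `x₅` are a linear and a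
quadratic form in `A`, and `Z` is an isotropic subspace for the latter inside the kernel of the
former.

Everything about the dual surface `Σ` follows from properties of the fourfold `Y`.

* `Σ` is smooth because `Y` is (`isSmoothOfDim_dualEquations`). If the intersection of the
  Grassmannian with `ℙ(W°)` is not transverse at `u ∧ v`, then some nonzero form `A ∈ W` has `u`
  and `v` in its kernel; the differential of the Pfaffian at `A` is then a multiple of
  `B ↦ B(u, v)` (`sum_pfaffianAdjoint_eq_zero`), which is zero on `W`, so `Y` is singular at `A`.
* A line in `Σ` consists of the planes between a vector `z` and a three-dimensional space
  containing it. The map `A ↦ A(z, ·)` from `W` to `V*` takes values in the annihilator of this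
  space, so that its kernel has dimension at least three: `Y` contains a plane
  (`containsLinearSubspace_pfaffianForm`).

The smoothness of `Y` follows from that of the threefold `C`, which is an elimination
(`eq_zero_of_cubicGradient_eq_zero`). That `Y` contains no plane is proved by reduction modulo `3`.
A plane in `Y` specializes to a plane in the reduction of `Y` over the residue field of a valuation
ring of `ℂ` above `3` (`exists_residue_subspace`). On the corresponding three-dimensional space,
`f` is the cube of a linear form, hence additive, so that the derivative of `f` at each of its
vectors vanishes on it. In each of the Schubert cells of the Grassmannian these equations are
contradictory (`no_plane_of_charP_three`).
-/

namespace PfaffianCubic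

/-! ### Directional derivatives of polynomials -/

section Derivative

variable {σ K : Type*} [Fintype σ] [Field K]

/-- The derivative of the polynomial `f` at the point `x` in the direction `y`. -/
noncomputable def dirDeriv (x y : σ → K) (f : MvPolynomial σ K) : K :=
  ∑ i, gradient f x i * y i

variable (x y : σ → K)

@[simp]
theorem dirDeriv_add (f g : MvPolynomial σ K) :
    dirDeriv x y (f + g) = dirDeriv x y f + dirDeriv x y g := by
  simp [dirDeriv, gradient, add_mul, Finset.sum_add_distrib]

@[simp]
theorem dirDeriv_neg (f : MvPolynomial σ K) : dirDeriv x y (-f) = -dirDeriv x y f := by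
  simp [dirDeriv, gradient]

@[simp]
theorem dirDeriv_sub (f g : MvPolynomial σ K) :
    dirDeriv x y (f - g) = dirDeriv x y f - dirDeriv x y g := by
  simp [sub_eq_add_neg]

@[simp]
theorem dirDeriv_mul (f g : MvPolynomial σ K) :
    dirDeriv x y (f * g) =
      MvPolynomial.eval x f * dirDeriv x y g + dirDeriv x y f * MvPolynomial.eval x g := by
  simp only [dirDeriv, gradient, Derivation.leibniz, smul_eq_mul, map_add, map_mul,
    Finset.mul_sum, Finset.sum_mul, ← Finset.sum_add_distrib]
  exact Finset.sum_congr rfl fun i _ => by ring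

@[simp]
theorem dirDeriv_C (a : K) : dirDeriv x y (MvPolynomial.C a) = 0 := by
  simp [dirDeriv, gradient]

@[simp]
theorem dirDeriv_zero : dirDeriv x y (0 : MvPolynomial σ K) = 0 := by
  simp [dirDeriv, gradient]

@[simp]
theorem dirDeriv_X (i : σ) : dirDeriv x y (MvPolynomial.X i) = y i := by
  classical
  simp [dirDeriv, gradient, MvPolynomial.pderiv_X, Pi.single_apply, apply_ite]

theorem dirDeriv_sum {ι : Type*} (s : Finset ι) (f : ι → MvPolynomial σ K) :
    dirDeriv x y (∑ j ∈ s, f j) = ∑ j ∈ s, dirDeriv x y (f j) := by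
  classical
  induction s using Finset.induction_on with
  | empty => simp
  | insert a s ha ih => simp [Finset.sum_insert ha, ih]

theorem dirDeriv_single [DecidableEq σ] (i : σ) (f : MvPolynomial σ K) :
    dirDeriv x (Pi.single i 1) f = gradient f x i := by
  simp [dirDeriv, Pi.single_apply]

end Derivative

/-! ### The Pfaffian and its differential -/

section Pfaffian

variable {R : Type*} [CommRing R]

/-- The derivative at `A`, in the direction `B`, of the Pfaffian of the `4 × 4` submatrix on the
rows and columns `i, j, k, l`. -/
def pfaffian4Deriv (A B : Matrix (Fin 6) (Fin 6) R) (i j k l : Fin 6) : R :=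
  A i j * B k l + B i j * A k l - A i k * B j l - B i k * A j l + A i l * B j k + B i l * A j k

/-- The Pfaffian adjoint of a `6 × 6` skew-symmetric matrix: its entry at `(i, j)` is, up to sign,
the Pfaffian of the submatrix obtained by deleting the rows and columns `i` and `j`. -/
def pfaffianAdjoint (A : Matrix (Fin 6) (Fin 6) R) : Matrix (Fin 6) (Fin 6) R :=
  let p := pfaffian4 A
  !![0, p 2 3 4 5, -p 1 3 4 5, p 1 2 4 5, -p 1 2 3 5, p 1 2 3 4;
     -p 2 3 4 5, 0, p 0 3 4 5, -p 0 2 4 5, p 0 2 3 5, -p 0 2 3 4;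
     p 1 3 4 5, -p 0 3 4 5, 0, p 0 1 4 5, -p 0 1 3 5, p 0 1 3 4;
     -p 1 2 4 5, p 0 2 4 5, -p 0 1 4 5, 0, p 0 1 2 5, -p 0 1 2 4;
     p 1 2 3 5, -p 0 2 3 5, p 0 1 3 5, -p 0 1 2 5, 0, p 0 1 2 3;
     -p 1 2 3 4, p 0 2 3 4, -p 0 1 3 4, p 0 1 2 4, -p 0 1 2 3, 0]

/-- Summation over the Plücker indices. -/
theorem sum_pluckerIndex {M : Type*} [AddCommMonoid M] (F : Fin 6 → Fin 6 → M) :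
    ∑ p : PluckerIndex, F p.1.1 p.1.2 =
      F 0 1 + F 0 2 + F 0 3 + F 0 4 + F 0 5 + F 1 2 + F 1 3 + F 1 4 + F 1 5 + F 2 3 + F 2 4 +
        F 2 5 + F 3 4 + F 3 5 + F 4 5 := by
  have h : ∑ p : PluckerIndex, F p.1.1 p.1.2 =
      ∑ p : Fin 6 × Fin 6, if p.1 < p.2 then F p.1 p.2 else 0 := by
    rw [← Finset.sum_filter]
    exact (Finset.sum_subtype _ (by simp) fun p : Fin 6 × Fin 6 => F p.1 p.2).symm
  rw [h, Fintype.sum_prod_type]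
  have lt : ∀ i j : Fin 6, (i < j) = ((i : ℕ) < (j : ℕ)) := fun _ _ => rfl
  simp only [Fin.sum_univ_six, lt]
  simp [add_assoc]

/-- The entries of the Pfaffian adjoint above the diagonal are the partial derivatives of the
Pfaffian. The left-hand side is the directional derivative of the expansion of the Pfaffian along
the first row. -/
theorem pfaffianDeriv_eq (A B : Matrix (Fin 6) (Fin 6) R) :
    B 0 1 * pfaffian4 A 2 3 4 5 + A 0 1 * pfaffian4Deriv A B 2 3 4 5
      - (B 0 2 * pfaffian4 A 1 3 4 5 + A 0 2 * pfaffian4Deriv A B 1 3 4 5)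
      + (B 0 3 * pfaffian4 A 1 2 4 5 + A 0 3 * pfaffian4Deriv A B 1 2 4 5)
      - (B 0 4 * pfaffian4 A 1 2 3 5 + A 0 4 * pfaffian4Deriv A B 1 2 3 5)
      + (B 0 5 * pfaffian4 A 1 2 3 4 + A 0 5 * pfaffian4Deriv A B 1 2 3 4) =
    ∑ p : PluckerIndex, pfaffianAdjoint A p.1.1 p.1.2 * B p.1.1 p.1.2 := by
  rw [sum_pluckerIndex fun i j => pfaffianAdjoint A i j * B i j]
  simp only [pfaffianAdjoint, pfaffian4, pfaffian4Deriv, Matrix.of_apply, Matrix.cons_val]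
  ring

set_option maxHeartbeats 2000000 in
/-- The Pfaffian adjoint of `A`, as a bivector, is annihilated by the exterior product with any
vector in the kernel of `A`. -/
theorem wedge_pfaffianAdjoint {A : Matrix (Fin 6) (Fin 6) R}
    (hA : ∀ i j, A j i = -A i j) (hA' : ∀ i, A i i = 0) {u : Fin 6 → R}
    (hu : ∀ i, ∑ j, A i j * u j = 0) (i j k : Fin 6) :
    u i * pfaffianAdjoint A j k - u j * pfaffianAdjoint A i k + u k * pfaffianAdjoint A i j =
      0 := by
  simp only [Fin.sum_univ_six] at hu
  have h0 := hu 0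
  have h1 := hu 1
  have h2 := hu 2
  have h3 := hu 3
  have h4 := hu 4
  have h5 := hu 5
  clear hu
  simp only [hA', zero_mul] at h0 h1 h2 h3 h4 h5
  simp only [hA 0 1, hA 0 2, hA 0 3, hA 0 4, hA 0 5, hA 1 2, hA 1 3, hA 1 4, hA 1 5, hA 2 3,
    hA 2 4, hA 2 5, hA 3 4, hA 3 5, hA 4 5] at h0 h1 h2 h3 h4 h5
  clear hA hA'
  fin_cases i <;> fin_cases j <;> fin_cases k <;>
    simp only [pfaffianAdjoint, pfaffian4, Matrix.of_apply, Matrix.cons_val, Fin.reduceFinMk,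
      Fin.zero_eta, Fin.mk_one, Fin.isValue] <;>
    first | ring1 | grind

end Pfaffian

section Pfaffian

variable {R : Type*} [CommRing R]

theorem pfaffianAdjoint_mul {A : Matrix (Fin 6) (Fin 6) R}
    (hA : ∀ i j, A j i = -A i j) (hA' : ∀ i, A i i = 0) :
    pfaffianAdjoint A * A = -pfaffian A • (1 : Matrix (Fin 6) (Fin 6) R) := by
  ext i j
  rw [Matrix.mul_apply, Fin.sum_univ_six]
  fin_cases i <;> fin_cases j <;>
    simp [pfaffianAdjoint, pfaffian4, pfaffian, hA', hA 0 1, hA 0 2, hA 0 3, hA 0 4, hA 0 5,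
      hA 1 2, hA 1 3, hA 1 4, hA 1 5, hA 2 3, hA 2 4, hA 2 5, hA 3 4, hA 3 5, hA 4 5] <;> ring

variable {K : Type*} [Field K]

theorem pfaffian_eq_zero_of_mulVec {A : Matrix (Fin 6) (Fin 6) K}
    (hA : ∀ i j, A j i = -A i j) (hA' : ∀ i, A i i = 0) {u : Fin 6 → K} (hu0 : u ≠ 0)
    (hu : A.mulVec u = 0) : pfaffian A = 0 := by
  have h := congrArg (fun B : Matrix (Fin 6) (Fin 6) K => B.mulVec u) (pfaffianAdjoint_mul hA hA')
  simp only [← Matrix.mulVec_mulVec, hu, Matrix.mulVec_zero, Matrix.smul_mulVec,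
    Matrix.one_mulVec] at h
  simpa [hu0] using h.symm

/-- If two independent vectors `u`, `v` lie in the kernel of the skew form `A`, then the
differential of the Pfaffian at `A` is a multiple of `B ↦ B(u, v)`. -/
theorem sum_pfaffianAdjoint_eq_zero {A B : Matrix (Fin 6) (Fin 6) K}
    (hA : ∀ i j, A j i = -A i j) (hA' : ∀ i, A i i = 0) {u v : Fin 6 → K}
    (hu : A.mulVec u = 0) (hv : A.mulVec v = 0) {a b : Fin 6} (hab : u a * v b - u b * v a ≠ 0)
    (hB : ∑ p : PluckerIndex, B p.1.1 p.1.2 * (u p.1.1 * v p.1.2 - u p.1.2 * v p.1.1) = 0) :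
    ∑ p : PluckerIndex, pfaffianAdjoint A p.1.1 p.1.2 * B p.1.1 p.1.2 = 0 := by
  have wu := wedge_pfaffianAdjoint hA hA' (u := u) (congrFun hu)
  have wv := wedge_pfaffianAdjoint hA hA' (u := v) (congrFun hv)
  have key : ∀ i j, (u a * v b - u b * v a) * pfaffianAdjoint A i j =
      pfaffianAdjoint A a b * (u i * v j - u j * v i) := fun i j => by
    linear_combination v b * wu a i j - v a * wu b i j - u i * wv a b j + u j * wv a b i
  refine (mul_eq_zero.mp ?_).resolve_left hab
  rw [Finset.mul_sum, ← mul_zero (pfaffianAdjoint A a b), ← hB, Finset.mul_sum]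
  exact Finset.sum_congr rfl fun p _ => by linear_combination B p.1.1 p.1.2 * key p.1.1 p.1.2

end Pfaffian

/-! ### Smoothness of the dual surface -/

section DualSurface

variable {K : Type*} [Field K]

theorem eval_pfaffianForm {n : ℕ} (ψ : Fin n → Matrix (Fin 6) (Fin 6) K) (c : Fin n → K) :
    MvPolynomial.eval c (pfaffianForm ψ) = pfaffian (∑ m, c m • ψ m) := by
  have h : ∀ i j, MvPolynomial.eval c (∑ m, MvPolynomial.C (ψ m i j) * MvPolynomial.X m) =
      (∑ m, c m • ψ m) i j := by
    simp [Matrix.sum_apply, mul_comm]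
  simp only [pfaffianForm, pfaffian, pfaffian4, Matrix.of_apply, map_add, map_sub, map_mul, h]

theorem gradient_pfaffianForm {n : ℕ} (ψ : Fin n → Matrix (Fin 6) (Fin 6) K) (c : Fin n → K)
    (m : Fin n) : gradient (pfaffianForm ψ) c m =
      ∑ p : PluckerIndex, pfaffianAdjoint (∑ m, c m • ψ m) p.1.1 p.1.2 * ψ m p.1.1 p.1.2 := by
  have h1 : ∀ i j, MvPolynomial.eval c (∑ m, MvPolynomial.C (ψ m i j) * MvPolynomial.X m) =
      (∑ m, c m • ψ m) i j := by
    simp [Matrix.sum_apply, mul_comm]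
  have h2 : ∀ i j, dirDeriv c (Pi.single m 1)
      (∑ m, MvPolynomial.C (ψ m i j) * MvPolynomial.X m) = ψ m i j := by
    simp [dirDeriv_sum, Pi.single_apply]
  rw [← dirDeriv_single, ← pfaffianDeriv_eq]
  simp only [pfaffianForm, pfaffian, pfaffian4, Matrix.of_apply, dirDeriv_add, dirDeriv_sub,
    dirDeriv_mul, map_add, map_sub, map_mul, h1, h2, pfaffian4Deriv]
  ring

theorem skewMatrix_wedge {a : PluckerIndex → K} {u v : Fin 6 → K}
    (h : ∀ p, a p = u p.1.1 * v p.1.2 - u p.1.2 * v p.1.1) (i j : Fin 6) :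
    skewMatrix a i j = u i * v j - u j * v i := by
  simp only [skewMatrix, Matrix.of_apply]
  split_ifs with h1 h2
  · exact h _
  · rw [h]; ring
  · obtain rfl : i = j := le_antisymm (not_lt.mp h2) (not_lt.mp h1)
    ring

theorem skewMatrix_swap {R : Type*} [CommRing R] (a : PluckerIndex → R) (i j : Fin 6) :
    skewMatrix a j i = -skewMatrix a i j := by
  simp only [skewMatrix, Matrix.of_apply]
  rcases lt_trichotomy i j with h | h | h
  · simp [h, h.not_gt]
  · simp [h]
  · simp [h, h.not_gt]

theorem skewMatrix_self {R : Type*} [CommRing R] (a : PluckerIndex → R) (i : Fin 6) :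
    skewMatrix a i i = 0 := by
  simp [skewMatrix]

theorem skewMatrix_index {R : Type*} [CommRing R] (a : PluckerIndex → R) (p : PluckerIndex) :
    skewMatrix a p.1.1 p.1.2 = a p := by
  simp [skewMatrix, p.2]

theorem skewMatrix_single_of_ne {R : Type*} [CommRing R] {q : PluckerIndex} {i : Fin 6}
    (h1 : q.1.1 ≠ i) (h2 : q.1.2 ≠ i) (j : Fin 6) :
    skewMatrix (Pi.single q (1 : R)) i j = 0 := by
  simp only [skewMatrix, Matrix.of_apply, Pi.single_apply]
  split_ifs with h3 h4 h5 h6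
  · exact absurd (by rw [← h4]) h1
  · rfl
  · exact absurd (by rw [← h6]) h2
  · simp
  · rfl

@[simp]
theorem eval_skewMatrix_X (a : PluckerIndex → K) (i j : Fin 6) :
    MvPolynomial.eval a (skewMatrix MvPolynomial.X i j) = skewMatrix a i j := by
  simp only [skewMatrix, Matrix.of_apply]
  split_ifs <;> simp

@[simp]
theorem dirDeriv_skewMatrix_X (a b : PluckerIndex → K) (i j : Fin 6) :
    dirDeriv a b (skewMatrix MvPolynomial.X i j) = skewMatrix b i j := by
  simp only [skewMatrix, Matrix.of_apply]
  split_ifs <;> simp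

theorem dirDeriv_pfaffian4 (a b : PluckerIndex → K) (i j k l : Fin 6) :
    dirDeriv a b (pfaffian4 (skewMatrix MvPolynomial.X) i j k l) =
      pfaffian4Deriv (skewMatrix a) (skewMatrix b) i j k l := by
  simp only [pfaffian4, pfaffian4Deriv, dirDeriv_add, dirDeriv_sub, dirDeriv_mul,
    eval_skewMatrix_X, dirDeriv_skewMatrix_X]
  ring

theorem eval_linearForm (A : Matrix (Fin 6) (Fin 6) K) (a : PluckerIndex → K) :
    MvPolynomial.eval a (linearForm A) = ∑ p : PluckerIndex, A p.1.1 p.1.2 * a p := by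
  simp [linearForm]

theorem dirDeriv_linearForm (A : Matrix (Fin 6) (Fin 6) K) (a b : PluckerIndex → K) :
    dirDeriv a b (linearForm A) = ∑ p : PluckerIndex, A p.1.1 p.1.2 * b p := by
  simp [linearForm, dirDeriv_sum]

/-- The pairing of the skew form `A` with the bivector `u ∧ v` is `A(u, v)`. -/
theorem sum_pluckerIndex_wedge {A : Matrix (Fin 6) (Fin 6) K}
    (hA : ∀ i j, A j i = -A i j) (hA' : ∀ i, A i i = 0) (u v : Fin 6 → K) :
    ∑ p : PluckerIndex, A p.1.1 p.1.2 * (u p.1.1 * v p.1.2 - u p.1.2 * v p.1.1) =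
      u ⬝ᵥ A.mulVec v := by
  rw [sum_pluckerIndex fun i j => A i j * (u i * v j - u j * v i)]
  simp only [dotProduct, Matrix.mulVec, Fin.sum_univ_six, hA', hA 0 1, hA 0 2, hA 0 3, hA 0 4,
    hA 0 5, hA 1 2, hA 1 3, hA 1 4, hA 1 5, hA 2 3, hA 2 4, hA 2 5, hA 3 4, hA 3 5, hA 4 5]
  ring

/-- The Plücker quadrics that generate the Plücker ideal where the coordinate `p` is nonzero
are indexed by the `k < l` disjoint from `p`. -/
abbrev ComplementaryIndex (p : PluckerIndex) : Type :=
  {q : PluckerIndex // (q.1.1 ≠ p.1.1 ∧ q.1.1 ≠ p.1.2) ∧ q.1.2 ≠ p.1.1 ∧ q.1.2 ≠ p.1.2}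

theorem card_complementaryIndex (p : PluckerIndex) : Fintype.card (ComplementaryIndex p) = 6 := by
  revert p
  decide

/-- The equations of the dual surface where the Plücker coordinate `p` is nonzero. -/
noncomputable def localEquations {n : ℕ} (ψ : Fin n → Matrix (Fin 6) (Fin 6) K)
    (p : PluckerIndex) : ComplementaryIndex p ⊕ Fin n → MvPolynomial PluckerIndex K :=
  Sum.elim (fun q => pfaffian4 (skewMatrix MvPolynomial.X) p.1.1 p.1.2 q.1.1.1 q.1.1.2)
    fun m => linearForm (ψ m)

theorem localEquations_mem_span {n : ℕ} (ψ : Fin n → Matrix (Fin 6) (Fin 6) K)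
    (p : PluckerIndex) (i : ComplementaryIndex p ⊕ Fin n) :
    localEquations ψ p i ∈ Ideal.span (dualEquations ψ) := by
  apply Ideal.subset_span
  rcases i with q | m
  · exact Or.inl ⟨_, _, _, _, rfl⟩
  · exact Or.inr ⟨m, rfl⟩

/-- Where the Plücker coordinate `p` is nonzero, the local equations generate the ideal of the
dual surface. -/
theorem mul_mem_span_localEquations {n : ℕ} (ψ : Fin n → Matrix (Fin 6) (Fin 6) K)
    (p : PluckerIndex) {f : MvPolynomial PluckerIndex K} (hf : f ∈ dualEquations ψ) :
    MvPolynomial.X p ^ 2 * f ∈ Ideal.span (Set.range (localEquations ψ p)) := by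
  set I := Ideal.span (Set.range (localEquations ψ p))
  rcases hf with ⟨i, j, k, l, rfl⟩ | ⟨m, rfl⟩
  · set M : Matrix (Fin 6) (Fin 6) (MvPolynomial PluckerIndex K) := skewMatrix MvPolynomial.X
    have swap : ∀ i j, M j i = -M i j := skewMatrix_swap _
    have self : ∀ i, M i i = 0 := skewMatrix_self _
    have lt : ∀ k l, k < l → pfaffian4 M p.1.1 p.1.2 k l ∈ I := by
      intro k l hkl
      by_cases h : (k ≠ p.1.1 ∧ k ≠ p.1.2) ∧ l ≠ p.1.1 ∧ l ≠ p.1.2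
      · exact Ideal.subset_span ⟨Sum.inl ⟨⟨(k, l), hkl⟩, h⟩, rfl⟩
      · have h0 : pfaffian4 M p.1.1 p.1.2 k l = 0 := by
          simp only [pfaffian4]
          by_cases h1 : k = p.1.1
          · rw [h1, self, swap p.1.1 p.1.2]; ring
          by_cases h2 : k = p.1.2
          · rw [h2, self]; ring
          by_cases h3 : l = p.1.1
          · rw [h3, self, swap p.1.1 p.1.2, swap p.1.1 k]; ring
          by_cases h4 : l = p.1.2
          · rw [h4, self, swap k p.1.2]; ring
          exact absurd ⟨⟨h1, h2⟩, h3, h4⟩ h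
        rw [h0]; exact I.zero_mem
    have all : ∀ k l, pfaffian4 M p.1.1 p.1.2 k l ∈ I := by
      intro k l
      rcases lt_trichotomy k l with h | h | h
      · exact lt k l h
      · have h0 : pfaffian4 M p.1.1 p.1.2 k l = 0 := by
          subst h; simp only [pfaffian4, self]; ring
        rw [h0]; exact I.zero_mem
      · have h0 : pfaffian4 M p.1.1 p.1.2 k l = -pfaffian4 M p.1.1 p.1.2 l k := by
          simp only [pfaffian4, swap k l]; ring
        rw [h0]; exact I.neg_mem (lt l k h)
    have hX : (MvPolynomial.X p : MvPolynomial PluckerIndex K) = M p.1.1 p.1.2 :=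
      (skewMatrix_index _ p).symm
    -- modulo the local equations, `M a b * M i j` is the `2 × 2` minor `y i j` of the rows `a, b`
    -- of `M`, and these minors satisfy the Plücker relations identically
    set y : Fin 6 → Fin 6 → MvPolynomial PluckerIndex K :=
      fun i j => M p.1.1 i * M p.1.2 j - M p.1.1 j * M p.1.2 i with hy
    have prod : ∀ i j k l, M p.1.1 p.1.2 ^ 2 * (M i j * M k l) - y i j * y k l ∈ I := by
      intro i j k l
      have e : M p.1.1 p.1.2 ^ 2 * (M i j * M k l) - y i j * y k l =
          (M p.1.1 p.1.2 * M k l) * pfaffian4 M p.1.1 p.1.2 i j +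
            y i j * pfaffian4 M p.1.1 p.1.2 k l := by
        simp only [hy, pfaffian4]; ring
      rw [e]
      exact I.add_mem (I.mul_mem_left _ (all _ _)) (I.mul_mem_left _ (all _ _))
    have e : MvPolynomial.X p ^ 2 * pfaffian4 M i j k l =
        (M p.1.1 p.1.2 ^ 2 * (M i j * M k l) - y i j * y k l)
        - (M p.1.1 p.1.2 ^ 2 * (M i k * M j l) - y i k * y j l)
        + (M p.1.1 p.1.2 ^ 2 * (M i l * M j k) - y i l * y j k) := by
      simp only [hX, hy, pfaffian4]; ring
    rw [e]
    exact I.add_mem (I.sub_mem (prod _ _ _ _) (prod _ _ _ _)) (prod _ _ _ _)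
  · exact I.mul_mem_left _ (Ideal.subset_span ⟨Sum.inr m, rfl⟩)

/-- The dual surface is smooth if the Pfaffian hypersurface is. At a point `u ∧ v` where
the intersection of the Grassmannian with the linear space is not transverse, some form in the
span of the `ψ m` has both `u` and `v` in its kernel, and the Pfaffian hypersurface is singular
at this form. -/
theorem isSmoothOfDim_dualEquations [CharZero K] {ψ : Fin 6 → Matrix (Fin 6) (Fin 6) K}
    (hψ : ∀ m i j, ψ m j i = -ψ m i j)
    (hY : ∀ c : Fin 6 → K, c ≠ 0 → MvPolynomial.eval c (pfaffianForm ψ) = 0 →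
      gradient (pfaffianForm ψ) c ≠ 0) :
    IsSmoothOfDim (dualEquations ψ) 2 := by
  intro x hx0 hx
  have hψ' : ∀ m i, ψ m i i = 0 := fun m i => self_eq_neg.mp (hψ m i i)
  obtain ⟨u, v, huv⟩ := (isZero_pluckerQuadrics_iff x).mp fun f hf => hx f (Or.inl hf)
  obtain ⟨p, hp⟩ := Function.ne_iff.mp hx0
  have hp' : u p.1.1 * v p.1.2 - u p.1.2 * v p.1.1 ≠ 0 := by rw [← huv]; exact hp
  have hu0 : u ≠ 0 := by rintro rfl; simp at hp'
  have hxψ : ∀ m, ∑ p : PluckerIndex, ψ m p.1.1 p.1.2 *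
      (u p.1.1 * v p.1.2 - u p.1.2 * v p.1.1) = 0 := fun m => by
    simp only [← huv, ← eval_linearForm]
    exact hx _ (Or.inr ⟨m, rfl⟩)
  have hcard : Fintype.card (ComplementaryIndex p ⊕ Fin 6) = 12 := by
    simp [card_complementaryIndex]
  let e := Fintype.equivFinOfCardEq hcard
  refine ⟨12, localEquations ψ p ∘ e.symm, MvPolynomial.X p ^ 2, by decide,
    fun j => localEquations_mem_span ψ p _, ?_, by simpa using hp, fun f hf => ?_⟩
  · suffices h : LinearIndependent K fun i => gradient (localEquations ψ p i) x from
      h.comp e.symm e.symm.injective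
    rw [Fintype.linearIndependent_iff]
    intro c hc
    -- the linear relation between the gradients, evaluated on a direction `y`
    have hdir : ∀ y : PluckerIndex → K,
        ∑ q : ComplementaryIndex p, c (Sum.inl q) * pfaffian4Deriv (skewMatrix x) (skewMatrix y)
          p.1.1 p.1.2 q.1.1.1 q.1.1.2 +
        ∑ r : PluckerIndex, (∑ m, c (Sum.inr m) • ψ m) r.1.1 r.1.2 * y r = 0 := by
      intro y
      have h1 : ∑ i, c i * dirDeriv x y (localEquations ψ p i) = 0 := by
        have := congrArg (fun g : PluckerIndex → K => ∑ r, g r * y r) hc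
        simp only [Finset.sum_apply, Pi.smul_apply, smul_eq_mul, Pi.zero_apply, zero_mul,
          Finset.sum_const_zero, Finset.sum_mul] at this
        rw [Finset.sum_comm] at this
        simpa only [dirDeriv, Finset.mul_sum, mul_assoc] using this
      rw [Fintype.sum_sum_type] at h1
      simp only [localEquations, Sum.elim_inl, Sum.elim_inr, dirDeriv_pfaffian4,
        dirDeriv_linearForm, Finset.mul_sum] at h1
      rw [Finset.sum_comm (s := Finset.univ (α := Fin 6))] at h1
      simpa only [Matrix.sum_apply, Matrix.smul_apply, smul_eq_mul, Finset.sum_mul,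
        mul_assoc] using h1
    set A := ∑ m, c (Sum.inr m) • ψ m with hAdef
    have hA : ∀ i j, A j i = -A i j := fun i j => by
      simp only [hAdef, Matrix.sum_apply, Matrix.smul_apply, hψ _ i j, smul_neg,
        Finset.sum_neg_distrib]
    have hA' : ∀ i, A i i = 0 := fun i => self_eq_neg.mp (hA i i)
    -- the tangent vectors `w ∧ t`, `t ∈ ⟨u, v⟩`, of the Grassmannian at `u ∧ v` are killed by the
    -- gradients of the Plücker quadrics
    have tangent : ∀ t : Fin 6 → K, (∃ α β : K, t = α • u + β • v) → A.mulVec t = 0 := by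
      rintro t ⟨α, β, ht⟩
      suffices h : ∀ w, w ⬝ᵥ A.mulVec t = 0 from dotProduct_eq_zero _ fun w => by
        rw [dotProduct_comm]; exact h w
      intro w
      rw [← sum_pluckerIndex_wedge hA hA', ← hdir fun r => w r.1.1 * t r.1.2 - w r.1.2 * t r.1.1]
      rw [right_eq_add]
      refine Finset.sum_eq_zero fun q _ => ?_
      have hwt : ∀ i j, skewMatrix (fun r : PluckerIndex => w r.1.1 * t r.1.2 - w r.1.2 * t r.1.1)
          i j = w i * t j - w j * t i := skewMatrix_wedge fun _ => rfl
      simp only [pfaffian4Deriv, skewMatrix_wedge huv, hwt]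
      simp only [ht, Pi.add_apply, Pi.smul_apply, smul_eq_mul]
      ring
    have hAu := tangent u ⟨1, 0, by simp⟩
    have hAv := tangent v ⟨0, 1, by simp⟩
    have hr : (fun m => c (Sum.inr m)) = 0 := by
      by_contra hne
      refine hY _ hne ?_ (funext fun m => ?_)
      · rw [eval_pfaffianForm]
        exact pfaffian_eq_zero_of_mulVec hA hA' hu0 hAu
      · rw [gradient_pfaffianForm]
        exact sum_pfaffianAdjoint_eq_zero hA hA' hAu hAv hp' (hxψ m)
    have hA0 : A = 0 := by
      rw [hAdef]
      exact Finset.sum_eq_zero fun m _ => by rw [congrFun hr m]; simp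
    have hl : ∀ q, c (Sum.inl q) = 0 := by
      intro q
      have h1 := hdir (Pi.single q.1 1)
      -- in the direction of the coordinate `q` disjoint from `p`, only the quadric `q` varies
      have h2 : ∀ r : ComplementaryIndex p, pfaffian4Deriv (skewMatrix x)
          (skewMatrix (Pi.single q.1 1)) p.1.1 p.1.2 r.1.1.1 r.1.1.2 =
          x p * (Pi.single q.1 1 : PluckerIndex → K) r.1 := fun r => by
        have ha := skewMatrix_single_of_ne (R := K) q.2.1.1 q.2.2.1
        have hb := skewMatrix_single_of_ne (R := K) q.2.1.2 q.2.2.2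
        simp only [pfaffian4Deriv, ha, hb, skewMatrix_index]
        ring
      simp only [hA0, h2, Matrix.zero_apply, zero_mul, Finset.sum_const_zero, add_zero,
        Pi.single_apply, Subtype.coe_inj] at h1
      have hp0 : x p ≠ 0 := hp
      simpa [hp0] using h1
    rintro (q | m)
    · exact hl q
    · exact congrFun hr m
  · have hrange : Set.range (localEquations ψ p ∘ e.symm) = Set.range (localEquations ψ p) :=
      e.symm.surjective.range_comp _
    rw [hrange]
    exact mul_mem_span_localEquations ψ p hf

end DualSurface

/-! ### Lines in the dual surface -/

section Lines

variable {K : Type*} [Field K]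

/-- The bivector `u ∧ v`. -/
def wedge (u v : Fin 6 → K) : PluckerIndex → K :=
  fun p => u p.1.1 * v p.1.2 - u p.1.2 * v p.1.1

theorem skewMatrix_wedge_apply (u v : Fin 6 → K) (i j : Fin 6) :
    skewMatrix (wedge u v) i j = u i * v j - u j * v i :=
  skewMatrix_wedge (fun _ => rfl) i j

theorem skewMatrix_add (a b : PluckerIndex → K) (i j : Fin 6) :
    skewMatrix (a + b) i j = skewMatrix a i j + skewMatrix b i j := by
  simp only [skewMatrix, Matrix.of_apply]
  split_ifs <;> simp [add_comm]

/-- A nonzero vector `z` of the plane `⟨u, v⟩` divides the bivector `u ∧ v`. -/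
theorem exists_wedge_eq_of_mem_span {u v z : Fin 6 → K} (hz0 : z ≠ 0) {β γ : K}
    (hz : z = β • u + γ • v) : ∃ w, wedge u v = wedge z w := by
  by_cases hβ : β = 0
  · have hγ : γ ≠ 0 := by
      rintro rfl
      simp [hβ] at hz
      exact hz0 hz
    refine ⟨-γ⁻¹ • u, funext fun p => ?_⟩
    simp only [wedge, hz, hβ, Pi.add_apply, Pi.smul_apply, smul_eq_mul]
    field_simp
    ring
  · refine ⟨β⁻¹ • v, funext fun p => ?_⟩
    simp only [wedge, hz, Pi.add_apply, Pi.smul_apply, smul_eq_mul]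
    field_simp
    ring

/-- The two-dimensional spaces of two decomposable bivectors whose sum is decomposable
have a common vector. -/
theorem exists_common_vector {u v u' v' : Fin 6 → K} (h0 : wedge u v ≠ 0)
    (h0' : wedge u' v' ≠ 0)
    (h : ∀ i j k l, pfaffian4Deriv (skewMatrix (wedge u v)) (skewMatrix (wedge u' v')) i j k l = 0) :
    ∃ z w w', wedge u v = wedge z w ∧ wedge u' v' = wedge z w' := by
  -- the coordinates of `a ∧ u' ∧ v'`; the hypothesis says that `u ∧ v ∧ u' ∧ v' = 0`, so that `u`
  -- is in the span of `v`, `u'` and `v'` unless `v` is in the span of `u'` and `v'`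
  let T : (Fin 6 → K) → Fin 6 → Fin 6 → Fin 6 → K := fun a j k l =>
    a j * (u' k * v' l - u' l * v' k) - a k * (u' j * v' l - u' l * v' j)
      + a l * (u' j * v' k - u' k * v' j)
  by_cases hT : ∃ j k l, T v j k l ≠ 0
  · obtain ⟨j, k, l, hT⟩ := hT
    obtain ⟨z, hz, hzspan⟩ : ∃ z, z = u - (T u j k l / T v j k l) • v ∧
        ∃ β γ : K, z = β • u' + γ • v' := by
      refine ⟨_, rfl, -(v' j * (u k * v l - u l * v k) - v' k * (u j * v l - u l * v j)
        + v' l * (u j * v k - u k * v j)) / T v j k l,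
        (u' j * (u k * v l - u l * v k) - u' k * (u j * v l - u l * v j)
        + u' l * (u j * v k - u k * v j)) / T v j k l, funext fun i => ?_⟩
      have e := h i j k l
      simp only [pfaffian4Deriv, skewMatrix_wedge_apply] at e
      simp only [Pi.sub_apply, Pi.add_apply, Pi.smul_apply, smul_eq_mul]
      field_simp
      simp only [T]
      linear_combination e
    have hzv : wedge u v = wedge z v := funext fun p => by
      simp only [wedge, hz, Pi.sub_apply, Pi.smul_apply, smul_eq_mul]; ring
    have hz0 : z ≠ 0 := by
      rintro rfl
      exact h0 (hzv.trans (funext fun p => by simp [wedge]))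
    obtain ⟨β, γ, hβγ⟩ := hzspan
    obtain ⟨w', hw'⟩ := exists_wedge_eq_of_mem_span hz0 hβγ
    exact ⟨z, v, w', hzv, hw'⟩
  · push Not at hT
    have hv0 : v ≠ 0 := by
      rintro rfl
      exact h0 (funext fun p => by simp [wedge])
    obtain ⟨p, hp⟩ := Function.ne_iff.mp h0'
    have hp' : u' p.1.1 * v' p.1.2 - u' p.1.2 * v' p.1.1 ≠ 0 := hp
    have hspan : v = ((v p.1.1 * v' p.1.2 - v p.1.2 * v' p.1.1) /
        (u' p.1.1 * v' p.1.2 - u' p.1.2 * v' p.1.1)) • u' +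
        ((v p.1.2 * u' p.1.1 - v p.1.1 * u' p.1.2) /
        (u' p.1.1 * v' p.1.2 - u' p.1.2 * v' p.1.1)) • v' := funext fun i => by
      have e := hT i p.1.1 p.1.2
      simp only [T] at e
      simp only [Pi.add_apply, Pi.smul_apply, smul_eq_mul]
      rw [div_mul_eq_mul_div, div_mul_eq_mul_div, ← add_div, eq_div_iff hp']
      linear_combination e
    obtain ⟨w', hw'⟩ := exists_wedge_eq_of_mem_span hv0 hspan
    refine ⟨v, -u, w', funext fun p => ?_, hw'⟩
    simp only [wedge, Pi.neg_apply]
    ring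

/-- If the forms `ψ m` vanish on a line of the Grassmannian, which is the pencil of the planes
`⟨z, αw + βw'⟩`, then the forms in their span whose kernel contains `z` make up a space of
dimension at least three, on which the Pfaffian vanishes. -/
theorem containsLinearSubspace_pfaffianForm [CharZero K] {ψ : Fin 6 → Matrix (Fin 6) (Fin 6) K}
    (hψ : ∀ m i j, ψ m j i = -ψ m i j) (h : ContainsLinearSubspace (dualEquations ψ) 1) :
    ContainsLinearSubspace {pfaffianForm ψ} 2 := by
  obtain ⟨L, hL, hzero⟩ := h
  let b := Module.finBasisOfFinrankEq K L hL
  have hplucker : ∀ x ∈ L, ∀ i j k l, pfaffian4 (skewMatrix x) i j k l = 0 := by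
    intro x hx i j k l
    have := hzero x hx _ (Or.inl ⟨i, j, k, l, rfl⟩)
    simpa [pfaffian4] using this
  have hlin : LinearIndependent K ![(b 0 : PluckerIndex → K), b 1] := by
    have := b.linearIndependent.map' L.subtype L.ker_subtype
    have hb : L.subtype ∘ b = ![(b 0 : PluckerIndex → K), b 1] := by
      funext i
      fin_cases i <;> rfl
    rwa [hb] at this
  obtain ⟨u, v, huv⟩ := (isZero_pluckerQuadrics_iff _).mp fun f hf =>
    hzero _ (b 0).2 f (Or.inl hf)
  obtain ⟨u', v', huv'⟩ := (isZero_pluckerQuadrics_iff _).mp fun f hf =>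
    hzero _ (b 1).2 f (Or.inl hf)
  replace huv : (b 0 : PluckerIndex → K) = wedge u v := funext huv
  replace huv' : (b 1 : PluckerIndex → K) = wedge u' v' := funext huv'
  obtain ⟨z, w, w', hw, hw'⟩ := exists_common_vector (u := u) (v := v) (u' := u') (v' := v')
    (huv ▸ hlin.ne_zero 0) (huv' ▸ hlin.ne_zero 1) (fun i j k l => by
      have h1 := hplucker _ (b 0).2 i j k l
      have h2 := hplucker _ (b 1).2 i j k l
      have h3 := hplucker _ (L.add_mem (b 0).2 (b 1).2) i j k l
      rw [← huv, ← huv']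
      simp only [pfaffian4, skewMatrix_add] at h1 h2 h3
      simp only [pfaffian4Deriv]
      linear_combination h3 - h1 - h2)
  rw [huv, hw, huv', hw', LinearIndependent.pair_iff] at hlin
  have hindep : LinearIndependent K ![z, w, w'] := by
    rw [Fintype.linearIndependent_iff]
    intro g hg
    simp only [Fin.sum_univ_three, Matrix.cons_val] at hg
    obtain ⟨h1, h2⟩ := hlin (g 1) (g 2) (funext fun p => by
      have e1 := congrFun hg p.1.1
      have e2 := congrFun hg p.1.2
      simp only [Pi.add_apply, Pi.smul_apply, smul_eq_mul, Pi.zero_apply] at e1 e2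
      simp only [wedge, Pi.add_apply, Pi.smul_apply, smul_eq_mul, Pi.zero_apply]
      linear_combination z p.1.1 * e2 - z p.1.2 * e1)
    have hz0 : z ≠ 0 := by
      rintro rfl
      obtain ⟨h3, -⟩ := hlin 1 0 (funext fun p => by simp [wedge])
      exact one_ne_zero h3
    have h0 : g 0 = 0 := by simpa [h1, h2, hz0] using hg
    intro i
    fin_cases i <;> assumption
  have hz0 : z ≠ 0 := hindep.ne_zero 0
  have hskew : ∀ (c : Fin 6 → K) i j, (∑ m, c m • ψ m) j i = -(∑ m, c m • ψ m) i j := by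
    intro c i j
    simp only [Matrix.sum_apply, Matrix.smul_apply, hψ _ i j, smul_neg, Finset.sum_neg_distrib]
  have hdiag : ∀ (c : Fin 6 → K) i, (∑ m, c m • ψ m) i i = 0 :=
    fun c i => self_eq_neg.mp (hskew c i i)
  -- the map `A ↦ A(z, ·)` on the span of the `ψ m`
  let Φ : (Fin 6 → K) →ₗ[K] (Fin 6 → K) :=
    { toFun := fun c => (∑ m, c m • ψ m).mulVec z
      map_add' := fun c d => by simp [add_smul, Finset.sum_add_distrib, Matrix.add_mulVec]
      map_smul' := fun a c => by
        simp [mul_smul, ← Finset.smul_sum, Matrix.smul_mulVec] }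
  have hdot : ∀ (c t : Fin 6 → K), wedge z t ∈ L → t ⬝ᵥ (∑ m, c m • ψ m).mulVec z = 0 := by
    intro c t ht
    rw [← sum_pluckerIndex_wedge (hskew c) (hdiag c)]
    have h1 : ∀ m, ∑ p : PluckerIndex, ψ m p.1.1 p.1.2 * wedge z t p = 0 := fun m => by
      rw [← eval_linearForm]
      exact hzero _ ht _ (Or.inr ⟨m, rfl⟩)
    have h2 : ∑ m, c m * ∑ p : PluckerIndex, ψ m p.1.1 p.1.2 * wedge z t p = 0 := by simp [h1]
    simp only [Finset.mul_sum] at h2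
    rw [Finset.sum_comm] at h2
    rw [← neg_eq_zero, ← h2, ← Finset.sum_neg_distrib]
    refine Finset.sum_congr rfl fun p _ => ?_
    simp only [Matrix.sum_apply, Matrix.smul_apply, smul_eq_mul, Finset.sum_mul,
      ← Finset.sum_neg_distrib, wedge]
    exact Finset.sum_congr rfl fun m _ => by ring
  let B : Matrix (Fin 3) (Fin 6) K := Matrix.of ![z, w, w']
  have hB : Module.finrank K (LinearMap.ker B.mulVecLin) = 3 := by
    have h1 := B.mulVecLin.finrank_range_add_finrank_ker
    have h2 : B.rank = 3 := by simpa using LinearIndependent.rank_matrix (M := B) hindep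
    rw [Matrix.rank] at h2
    rw [h2] at h1
    simp only [Module.finrank_fin_fun] at h1
    omega
  have hrange : LinearMap.range Φ ≤ LinearMap.ker B.mulVecLin := by
    rintro _ ⟨c, rfl⟩
    rw [LinearMap.mem_ker, Matrix.mulVecLin_apply]
    funext i
    fin_cases i
    · exact hdot c z (by convert L.zero_mem; funext p; simp only [wedge, Pi.zero_apply]; ring)
    · exact hdot c w (by rw [← hw, ← huv]; exact (b 0).2)
    · exact hdot c w' (by rw [← hw', ← huv']; exact (b 1).2)
  have hker : 3 ≤ Module.finrank K (LinearMap.ker Φ) := by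
    have h1 := Φ.finrank_range_add_finrank_ker
    have h2 := Submodule.finrank_mono hrange
    simp only [Module.finrank_fin_fun] at h1
    omega
  obtain ⟨g, hg⟩ := exists_linearIndependent_of_le_finrank hker
  have hg' := hg.map' (LinearMap.ker Φ).subtype (Submodule.ker_subtype _)
  refine ⟨_, (finrank_span_eq_card hg').trans (by simp), fun c hc f hf => ?_⟩
  have hcΦ : c ∈ LinearMap.ker Φ :=
    (Submodule.span_le.mpr (by rintro _ ⟨i, rfl⟩; exact (g i).2)) hc
  rw [Set.mem_singleton_iff.mp hf, eval_pfaffianForm]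
  exact pfaffian_eq_zero_of_mulVec (hskew c) (hdiag c) hz0 hcΦ

end Lines

/-! ### Echelon forms -/

section CoordinateSubspaces

variable {K : Type*} [Field K] {n : ℕ}

theorem finrank_inf_ker_proj {L : Submodule K (Fin n → K)} {d : ℕ}
    (hL : Module.finrank K L = d + 1) {u : Fin n → K} (hu : u ∈ L) {i : Fin n} (hui : u i ≠ 0) :
    Module.finrank K ↥(L ⊓ LinearMap.ker (LinearMap.proj (R := K) (φ := fun _ => K) i)) = d := by
  set p : (Fin n → K) →ₗ[K] K := LinearMap.proj i
  have hsurj : LinearMap.range (p.domRestrict L) = ⊤ := by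
    refine LinearMap.range_eq_top.mpr fun c => ⟨(c / u i) • ⟨u, hu⟩, ?_⟩
    simp [p, hui]
  have h := (p.domRestrict L).finrank_range_add_finrank_ker
  rw [hsurj, finrank_top, Module.finrank_self, hL] at h
  rw [← Submodule.map_comap_subtype, Submodule.finrank_map_subtype_eq]
  have : Submodule.comap L.subtype (LinearMap.ker p) = LinearMap.ker (p.domRestrict L) := rfl
  rw [this]
  omega

/-- A nonzero subspace has a first pivot `i` in its row echelon form. -/
theorem exists_pivot {L : Submodule K (Fin n → K)} {d : ℕ} (hL : Module.finrank K L = d + 1) :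
    ∃ i, ∃ u ∈ L, u i = 1 ∧ (∀ x ∈ L, ∀ l < i, x l = 0) ∧
      Module.finrank K ↥(L ⊓ LinearMap.ker (LinearMap.proj (R := K) (φ := fun _ => K) i)) = d := by
  classical
  have hne : ∃ i, ∃ x ∈ L, x i ≠ 0 := by
    by_contra! h
    have : L = ⊥ := (Submodule.eq_bot_iff L).mpr fun x hx => funext fun i => h i x hx
    rw [this, finrank_bot] at hL
    omega
  have hmin := Fin.find_spec hne
  obtain ⟨x, hx, hxi⟩ := hmin
  refine ⟨Fin.find _ hne, (x (Fin.find _ hne))⁻¹ • x, L.smul_mem _ hx, by simp [hxi], ?_,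
    finrank_inf_ker_proj hL hx hxi⟩
  intro y hy l hl
  by_contra h
  exact Fin.find_min hne hl ⟨y, hy, h⟩

/-- The reduced row echelon form of a subspace of dimension three, with pivots `i < j < k`. -/
theorem exists_rowEchelon {L : Submodule K (Fin n → K)} (hL : Module.finrank K L = 3) :
    ∃ i j k : Fin n, i < j ∧ j < k ∧ ∃ u ∈ L, ∃ v ∈ L, ∃ w ∈ L,
      (u i = 1 ∧ u j = 0 ∧ u k = 0) ∧ (v i = 0 ∧ v j = 1 ∧ v k = 0) ∧
      (w i = 0 ∧ w j = 0 ∧ w k = 1) ∧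
      (∀ l < i, u l = 0) ∧ (∀ l < j, v l = 0) ∧ ∀ l < k, w l = 0 := by
  obtain ⟨i, u, hu, hui, hi, hL1⟩ := exists_pivot hL
  obtain ⟨j, v, hv, hvj, hj, hL2⟩ := exists_pivot hL1
  obtain ⟨k, w, hw, hwk, hk, -⟩ := exists_pivot hL2
  simp only [Submodule.mem_inf, LinearMap.mem_ker, LinearMap.proj_apply] at hv hw hj hk
  have hv' : ∀ l < j, v l = 0 := hj v hv
  have hw' : ∀ l < k, w l = 0 := hk w hw
  have hij : i < j := by
    by_contra h
    rcases (not_lt.mp h).lt_or_eq with h | h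
    · simp [hi v hv.1 j h] at hvj
    · rw [h, hv.2] at hvj; simp at hvj
  have hjk : j < k := by
    by_contra h
    rcases (not_lt.mp h).lt_or_eq with h | h
    · simp [hj w hw.1 k h] at hwk
    · rw [h, hw.2] at hwk; simp at hwk
  refine ⟨i, j, k, hij, hjk, u - u j • v - (u k - u j * v k) • w,
    L.sub_mem (L.sub_mem hu (L.smul_mem _ hv.1)) (L.smul_mem _ hw.1.1),
    v - v k • w, L.sub_mem hv.1 (L.smul_mem _ hw.1.1), w, hw.1.1, ?_, ?_, ?_, ?_, ?_, hw'⟩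
  · simp [hui, hv.2, hw.1.2, hvj, hw.2, hwk]
  · simp [hv.2, hw.1.2, hvj, hw.2, hwk]
  · simp [hw.1.2, hw.2, hwk]
  · intro l hl
    simp [hi u hu l hl, hv' l (hl.trans hij), hw' l (hl.trans (hij.trans hjk))]
  · intro l hl
    simp [hv' l hl, hw' l (hl.trans hjk)]

end CoordinateSubspaces

/-! ### Reduction of linear subspaces modulo a prime -/

section Reduction

variable {K : Type*} [Field K] {n : ℕ}

/-- A subspace of `Kⁿ` specializes to a subspace of the same dimension over the residue field of
a valuation ring `O` of `K`: it contains integral vectors whose reductions are independent. -/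
theorem exists_linearIndependent_residue (O : ValuationSubring K) {d : ℕ}
    {L : Submodule K (Fin n → K)} (hL : Module.finrank K L = d) :
    ∃ b : Fin d → Fin n → O, (∀ j, (fun i => (b j i : K)) ∈ L) ∧
      LinearIndependent (IsLocalRing.ResidueField O)
        fun j i => IsLocalRing.residue O (b j i) := by
  induction d generalizing L with
  | zero => exact ⟨Fin.elim0, fun j => j.elim0, linearIndependent_empty_type⟩
  | succ d ih =>
    obtain ⟨x, hx, hx0⟩ : ∃ x ∈ L, x ≠ 0 := by
      refine L.ne_bot_iff.mp ?_
      rintro rfl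
      simp at hL
    obtain ⟨j, hj⟩ := Function.ne_iff.mp hx0
    have : Nonempty (Fin n) := ⟨j⟩
    -- divide by a coordinate of maximal valuation
    obtain ⟨i, hi⟩ := Finite.exists_max fun i => O.valuation (x i)
    have hxi : x i ≠ 0 := by
      intro h
      have := hi j
      rw [h, map_zero, le_zero_iff, map_eq_zero] at this
      exact hj this
    have hmem : ∀ l, (x i)⁻¹ * x l ∈ O := fun l => by
      rw [← O.valuation_le_one_iff, map_mul, map_inv₀]
      calc (O.valuation (x i))⁻¹ * O.valuation (x l)
          ≤ (O.valuation (x i))⁻¹ * O.valuation (x i) := by gcongr; exact hi l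
        _ = 1 := inv_mul_cancel₀ (by simpa using hxi)
    obtain ⟨b, hb, hlin⟩ := ih (finrank_inf_ker_proj hL hx hxi)
    refine ⟨Fin.cons (fun l => ⟨_, hmem l⟩) b, fun j => ?_, ?_⟩
    · refine Fin.cases ?_ (fun j => ?_) j
      · exact L.smul_mem (x i)⁻¹ hx
      · exact (hb j).1
    · have hcons : (fun (j : Fin (d + 1)) l => IsLocalRing.residue O
          ((Fin.cons (fun l => ⟨_, hmem l⟩) b : Fin (d + 1) → Fin n → O) j l)) =
          Fin.cons (fun l => IsLocalRing.residue O ⟨_, hmem l⟩)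
            fun j l => IsLocalRing.residue O (b j l) := by
        funext j
        refine Fin.cases rfl (fun j => rfl) j
      rw [hcons, linearIndependent_finCons]
      refine ⟨hlin, fun hspan => ?_⟩
      have hle : Submodule.span (IsLocalRing.ResidueField O)
          (Set.range fun j l => IsLocalRing.residue O (b j l)) ≤ LinearMap.ker
            (LinearMap.proj (R := IsLocalRing.ResidueField O)
              (φ := fun _ : Fin n => IsLocalRing.ResidueField O) i) := by
        rw [Submodule.span_le]
        rintro _ ⟨j, rfl⟩
        have : b j i = 0 := Subtype.ext (hb j).2
        simp [this]
      have h0 := hle hspan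
      have h1 : (⟨(x i)⁻¹ * x i, hmem i⟩ : O) = 1 := Subtype.ext (inv_mul_cancel₀ hxi)
      simp [h1] at h0

/-- Linear subspaces of a hypersurface with integral equation `P` specialize. -/
theorem exists_residue_subspace (O : ValuationSubring K) (P : MvPolynomial (Fin n) ℤ) {d : ℕ}
    {L : Submodule K (Fin n → K)} (hL : Module.finrank K L = d)
    (hP : ∀ x ∈ L, MvPolynomial.aeval x P = 0) :
    ∃ L' : Submodule (IsLocalRing.ResidueField O) (Fin n → IsLocalRing.ResidueField O),
      Module.finrank (IsLocalRing.ResidueField O) L' = d ∧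
        ∀ x ∈ L', MvPolynomial.aeval x P = 0 := by
  obtain ⟨b, hb, hlin⟩ := exists_linearIndependent_residue O hL
  refine ⟨_, by simpa using finrank_span_eq_card hlin, fun x hx => ?_⟩
  obtain ⟨c, rfl⟩ := (Submodule.mem_span_range_iff_exists_fun _).mp hx
  choose c' hc' using fun j => IsLocalRing.residue_surjective (c j)
  set y : Fin n → O := ∑ j, c' j • b j with hy
  have hyL : (fun i => (y i : K)) ∈ L := by
    have : (fun i => (y i : K)) = ∑ j, (c' j : K) • fun i => (b j i : K) := by
      funext i
      simp [hy, Finset.sum_apply]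
    rw [this]
    exact L.sum_mem fun j _ => L.smul_mem _ (hb j)
  have hyP : MvPolynomial.aeval y P = 0 := by
    have h := hP _ hyL
    have h2 : MvPolynomial.aeval (fun i => (y i : K)) P =
        ((MvPolynomial.aeval y P : O) : K) := by
      exact (MvPolynomial.aeval_algebraMap_apply K y P)
    rw [h2] at h
    exact_mod_cast h
  have hyx : (∑ j, c j • fun i => IsLocalRing.residue O (b j i)) =
      fun i => algebraMap O (IsLocalRing.ResidueField O) (y i) := by
    funext i
    simp [hy, Finset.sum_apply, ← hc']
  have h3 := MvPolynomial.aeval_algebraMap_apply (IsLocalRing.ResidueField O) y P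
  rw [hyP, map_zero] at h3
  rw [hyx]
  exact h3

/-- A field of characteristic zero has a valuation ring whose residue field has characteristic
a given prime. -/
theorem exists_valuationSubring_charP (K : Type*) [Field K] [CharZero K] (p : ℕ) (hp : p.Prime) :
    ∃ O : ValuationSubring K, CharP (IsLocalRing.ResidueField O) p := by
  let A : Subring K := (Int.castRingHom K).range
  have hI : Ideal.span {(p : A)} ≠ ⊤ := by
    rw [Ne, Ideal.span_singleton_eq_top]
    intro h
    obtain ⟨⟨_, m, rfl⟩, hm⟩ := h.exists_right_inv
    have h2 : (p : K) * (m : K) = 1 := by simpa using congrArg Subtype.val hm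
    have h3 : (p : ℤ) * m = 1 := by exact_mod_cast h2
    exact hp.one_lt.ne' (by exact_mod_cast Int.eq_one_of_mul_eq_one_right (by positivity) h3)
  obtain ⟨O, -, hO⟩ := Ideal.image_subset_nonunits_valuationSubring _ hI
  refine ⟨O, (CharP.charP_iff_prime_eq_zero hp).mpr ?_⟩
  have hmem : (p : K) ∈ O.nonunits :=
    hO ⟨(p : A), Ideal.mem_span_singleton_self _, by simp⟩
  have h4 : (p : O) ∈ IsLocalRing.maximalIdeal O := by
    obtain ⟨h, h'⟩ := ValuationSubring.mem_nonunits_iff_exists_mem_maximalIdeal.mp hmem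
    convert h' using 1
    exact Subtype.ext (by simp)
  have h5 := (IsLocalRing.residue_eq_zero_iff (p : O)).mpr h4
  simpa using h5

end Reduction

/-! ### The example -/

section Example

/-- The cubic form `f` of the example. -/
def cubicForm {R : Type*} [CommRing R] (x : Fin 5 → R) : R :=
  x 0 ^ 3 + x 0 * x 1 ^ 2 - x 0 * x 2 * x 3 + x 1 * x 2 ^ 2 + x 2 ^ 2 * x 4 - x 2 * x 4 ^ 2
    + x 3 ^ 2 * x 4

/-- The generic member of the space `W` of the example. -/
def skewPencil {R : Type*} [CommRing R] (x : Fin 6 → R) : Matrix (Fin 6) (Fin 6) R :=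
  !![0, x 5, 0, x 0, x 2, x 3;
     -x 5, 0, x 4, x 2, -x 1, x 0;
     0, -x 4, 0, x 5, x 0, x 1;
     -x 0, -x 2, -x 5, 0, x 3, x 4 - x 2;
     -x 2, x 1, -x 0, -x 3, 0, x 5;
     -x 3, -x 0, -x 1, x 2 - x 4, -x 5, 0]

/-- The basis of the space `W` of the example, over the field `K`. -/
def basisForm (K : Type*) [Field K] (m : Fin 6) : Matrix (Fin 6) (Fin 6) K :=
  skewPencil (Pi.single m 1)

theorem pfaffian_skewPencil {R : Type*} [CommRing R] (x : Fin 6 → R) :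
    pfaffian (skewPencil x) = x 5 ^ 3 + cubicForm fun i => x i.castSucc := by
  simp only [pfaffian, pfaffian4, skewPencil, cubicForm, Matrix.of_apply, Matrix.cons_val,
    Fin.castSucc_zero, Fin.castSucc_one, Fin.reduceCastSucc]
  ring

theorem skewPencil_swap {R : Type*} [CommRing R] (x : Fin 6 → R) (i j : Fin 6) :
    skewPencil x j i = -skewPencil x i j := by
  fin_cases i <;> fin_cases j <;> simp [skewPencil]

variable {K : Type*} [Field K]

theorem sum_basisForm (i j : Fin 6) :
    ∑ m, MvPolynomial.C (basisForm K m i j) * MvPolynomial.X m =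
      skewPencil (R := MvPolynomial (Fin 6) K) MvPolynomial.X i j := by
  fin_cases i <;> fin_cases j <;>
    simp [basisForm, skewPencil, Fin.sum_univ_six, Pi.single_apply] <;> ring

theorem pfaffianForm_basisForm :
    pfaffianForm (basisForm K) =
      MvPolynomial.X 5 ^ 3 + cubicForm fun i => MvPolynomial.X i.castSucc := by
  rw [← pfaffian_skewPencil, pfaffianForm]
  congr 1
  ext1 i j
  exact sum_basisForm i j

theorem pfaffianForm_basisForm_castSucc :
    pfaffianForm (fun m : Fin 5 => basisForm K m.castSucc) = cubicForm MvPolynomial.X := by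
  -- this is the restriction to the hyperplane `x 5 = 0`
  have h : ∀ i j, ∑ m : Fin 5, MvPolynomial.C (basisForm K m.castSucc i j) * MvPolynomial.X m =
      skewPencil (R := MvPolynomial (Fin 5) K)
        (Fin.snoc (α := fun _ => MvPolynomial (Fin 5) K) MvPolynomial.X 0) i j := by
    intro i j
    have h1 := congrArg (MvPolynomial.aeval (Fin.snoc (α := fun _ => MvPolynomial (Fin 5) K)
      MvPolynomial.X 0)) (sum_basisForm (K := K) i j)
    rw [map_sum, Fin.sum_univ_castSucc] at h1
    simp only [map_mul, MvPolynomial.aeval_X, MvPolynomial.aeval_C, Fin.snoc_castSucc,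
      Fin.snoc_last, mul_zero, add_zero] at h1
    refine h1.trans ?_
    fin_cases i <;> fin_cases j <;> simp [skewPencil]
  rw [pfaffianForm]
  simp only [h]
  refine (pfaffian_skewPencil _).trans ?_
  have h5 : (Fin.snoc (α := fun _ => MvPolynomial (Fin 5) K) MvPolynomial.X 0 : Fin 6 → _) 5 = 0 :=
    Fin.snoc_last (n := 5) (α := fun _ => MvPolynomial (Fin 5) K) 0 MvPolynomial.X
  simp only [h5, Fin.snoc_castSucc]
  ring

theorem linearIndependent_basisForm : LinearIndependent K (basisForm K) := by
  rw [Fintype.linearIndependent_iff]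
  intro g hg
  have e := fun i j => congrFun (congrFun hg i) j
  have e0 := e 0 3
  have e1 := e 2 5
  have e2 := e 0 4
  have e3 := e 0 5
  have e4 := e 1 2
  have e5 := e 0 1
  simp [Matrix.sum_apply, basisForm, skewPencil, Pi.single_apply] at e0 e1 e2 e3 e4 e5
  intro i
  fin_cases i <;> assumption

/-- The partial derivatives of the cubic form `f`. -/
def cubicGradient {R : Type*} [CommRing R] (x : Fin 5 → R) : Fin 5 → R :=
  ![3 * x 0 ^ 2 + x 1 ^ 2 - x 2 * x 3, 2 * x 0 * x 1 + x 2 ^ 2,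
    -x 0 * x 3 + 2 * x 1 * x 2 + 2 * x 2 * x 4 - x 4 ^ 2, -x 0 * x 2 + 2 * x 3 * x 4,
    x 2 ^ 2 - 2 * x 2 * x 4 + x 3 ^ 2]

theorem gradient_cubicForm (x : Fin 5 → K) :
    gradient (cubicForm MvPolynomial.X) x = cubicGradient x := by
  funext i
  rw [← dirDeriv_single]
  fin_cases i <;>
    simp [cubicForm, cubicGradient, pow_succ, -mul_eq_mul_right_iff, -mul_eq_mul_left_iff] <;> ring

theorem eq_zero_of_cubicGradient_eq_zero [CharZero K] {x : Fin 5 → K}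
    (h : cubicGradient x = 0) : x = 0 := by
  have h0 := congrFun h 0
  have h1 := congrFun h 1
  have h2 := congrFun h 2
  have h3 := congrFun h 3
  have h4 := congrFun h 4
  simp only [cubicGradient, Matrix.cons_val, Pi.zero_apply] at h0 h1 h2 h3 h4
  -- eliminating the other variables shows that `x 2` is nilpotent modulo the partial derivatives
  have e2 : x 2 = 0 := by grind
  have e3 : x 3 = 0 := by grind
  have e4 : x 4 = 0 := by grind
  have e0 : x 0 = 0 := by grind
  have e1 : x 1 = 0 := by grind
  funext i
  fin_cases i <;> assumption

theorem gradient_pfaffianForm_basisForm_ne_zero [CharZero K] {x : Fin 6 → K} (hx : x ≠ 0) :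
    gradient (pfaffianForm (basisForm K)) x ≠ 0 := by
  intro h
  rw [pfaffianForm_basisForm] at h
  have h5 : x 5 = 0 := by
    have := congrFun h 5
    rw [← dirDeriv_single] at this
    simp [cubicForm, pow_succ] at this
    grind
  have hc : (fun i : Fin 5 => x i.castSucc) = 0 := by
    by_contra hne
    refine hne (eq_zero_of_cubicGradient_eq_zero (funext fun i => ?_))
    have := congrFun h i.castSucc
    rw [← gradient_cubicForm]
    rw [← dirDeriv_single] at this ⊢
    fin_cases i <;> simpa [cubicForm, pow_succ, Pi.single_apply] using this
  exact hx (funext (Fin.lastCases h5 (congrFun hc)))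

set_option maxHeartbeats 1000000 in
/-- In characteristic three, the fourfold `x₅³ + f = 0` contains no plane. -/
theorem no_plane_of_charP_three [CharP K 3] {L : Submodule K (Fin 6 → K)}
    (hL : Module.finrank K L = 3)
    (h : ∀ x ∈ L, x 5 ^ 3 + cubicForm (fun i => x i.castSucc) = 0) : False := by
  have h3 : (3 : K) = 0 := CharP.cast_eq_zero K 3
  -- `f` is the cube of a linear form on `L`, hence additive, so the derivative of `f` at any
  -- vector of `L` vanishes on `L`
  have hT : ∀ x ∈ L, ∀ y ∈ L,
      cubicGradient (fun i => x i.castSucc) ⬝ᵥ (fun i => y i.castSucc) = 0 := by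
    intro x hx y hy
    have e1 := h x hx
    have e2 := h y hy
    have e3 := h _ (L.add_mem hx hy)
    have e4 := h _ (L.sub_mem hx hy)
    simp only [cubicForm, Pi.add_apply, Pi.sub_apply, Fin.castSucc_zero, Fin.castSucc_one,
      Fin.reduceCastSucc] at e1 e2 e3 e4
    simp only [cubicGradient, dotProduct, Fin.sum_univ_five, Matrix.cons_val, Fin.castSucc_zero,
      Fin.castSucc_one, Fin.reduceCastSucc]
    grind
  obtain ⟨i, j, k, hij, hjk, u, hu, v, hv, w, hw, ⟨ui, uj, uk⟩, ⟨vi, vj, vk⟩, ⟨wi, wj, wk⟩,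
    hui, hvj, hwk⟩ := exists_rowEchelon hL
  have t1 := hT u hu v hv
  have t2 := hT v hv u hu
  have t3 := hT u hu w hw
  have t4 := hT w hw u hu
  have t5 := hT v hv w hw
  have t6 := hT w hw v hv
  have t7 := hT _ (L.add_mem hu hv) w hw
  have t8 := h w hw
  simp only [cubicGradient, cubicForm, dotProduct, Fin.sum_univ_five, Matrix.cons_val,
    Pi.add_apply, Fin.castSucc_zero, Fin.castSucc_one, Fin.reduceCastSucc]
    at t1 t2 t3 t4 t5 t6 t7 t8
  clear hT h hu hv hw hL
  have hu0 := hui 0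
  have hu1 := hui 1
  have hu2 := hui 2
  have hv0 := hvj 0
  have hv1 := hvj 1
  have hv2 := hvj 2
  have hv3 := hvj 3
  have hw0 := hwk 0
  have hw1 := hwk 1
  have hw2 := hwk 2
  have hw3 := hwk 3
  have hw4 := hwk 4
  clear hui hvj hwk
  -- the twenty Schubert cells; when `x 5` is a pivot, `t8` reads `1 = 0`
  fin_cases i <;> fin_cases j <;> first
    | exact absurd hij (by decide)
    | (fin_cases k <;> first
      | exact absurd hjk (by decide)
      | (simp only [Fin.isValue, Fin.reduceFinMk, Fin.zero_eta, Fin.mk_one, Fin.reduceLT,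
          Fin.zero_lt_one, forall_const, false_imp_iff, lt_self_iff_false, Fin.not_lt_zero] at *
         clear hij hjk
         grind))

end Example

/-! ### Extension of scalars to the complex numbers -/

section Complexification

/-- The Jacobian criterion for hypersurfaces. -/
theorem isSmoothOfDim_singleton {σ K : Type*} [Fintype σ] [Field K] {f : MvPolynomial σ K} {d : ℕ}
    (hd : d + 2 = Fintype.card σ)
    (h : ∀ x : σ → K, x ≠ 0 → MvPolynomial.eval x f = 0 → gradient f x ≠ 0) :
    IsSmoothOfDim {f} d := by
  intro x hx0 hx
  refine ⟨1, fun _ => f, 1, by omega, fun _ => Ideal.subset_span rfl,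
    linearIndependent_unique_iff.mpr (h x hx0 (hx f rfl)), by simp, ?_⟩
  rintro g rfl
  exact Ideal.mul_mem_left _ _ (Ideal.subset_span ⟨0, rfl⟩)

theorem complexify_pfaffianForm {n : ℕ} (φ : Fin n → Matrix (Fin 6) (Fin 6) ℚ) :
    complexify {pfaffianForm φ} = {pfaffianForm fun m => (φ m).map (algebraMap ℚ ℂ)} := by
  simp [complexify, pfaffianForm, pfaffian, pfaffian4]

theorem complexify_dualEquations {n : ℕ} (φ : Fin n → Matrix (Fin 6) (Fin 6) ℚ) :
    complexify (dualEquations φ) = dualEquations fun m => (φ m).map (algebraMap ℚ ℂ) := by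
  have hskew : ∀ i j, MvPolynomial.map (algebraMap ℚ ℂ) (skewMatrix MvPolynomial.X i j) =
      skewMatrix MvPolynomial.X i j := by
    intro i j
    simp only [skewMatrix, Matrix.of_apply]
    split_ifs <;> simp
  have hpf : ∀ i j k l, MvPolynomial.map (algebraMap ℚ ℂ)
      (pfaffian4 (skewMatrix MvPolynomial.X) i j k l) =
      pfaffian4 (skewMatrix MvPolynomial.X) i j k l := by
    simp [pfaffian4, hskew]
  rw [complexify, dualEquations, dualEquations, Set.image_union, ← Set.range_comp]
  congr 1
  · ext f
    constructor
    · rintro ⟨_, ⟨i, j, k, l, rfl⟩, rfl⟩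
      exact ⟨i, j, k, l, hpf i j k l⟩
    · rintro ⟨i, j, k, l, rfl⟩
      exact ⟨_, ⟨i, j, k, l, rfl⟩, hpf i j k l⟩
  · congr 1
    funext m
    simp [linearForm]

theorem map_basisForm (m : Fin 6) :
    (basisForm ℚ m).map (algebraMap ℚ ℂ) = basisForm ℂ m := by
  have h : ∀ i, (Pi.single m 1 : Fin 6 → ℂ) i = algebraMap ℚ ℂ ((Pi.single m 1 : Fin 6 → ℚ) i) := by
    intro i
    simp only [Pi.single_apply]
    split_ifs <;> simp
  ext i j
  fin_cases i <;> fin_cases j <;> simp [basisForm, skewPencil, h]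

theorem not_containsLinearSubspace_pfaffianForm (K : Type*) [Field K] [CharZero K] :
    ¬ ContainsLinearSubspace {pfaffianForm (basisForm K)} 2 := by
  rintro ⟨L, hL, hzero⟩
  obtain ⟨O, hO⟩ := exists_valuationSubring_charP K 3 Nat.prime_three
  obtain ⟨L', hL', hzero'⟩ := exists_residue_subspace O
    (MvPolynomial.X 5 ^ 3 + cubicForm fun i => MvPolynomial.X i.castSucc) hL (fun x hx => by
      have := hzero x hx _ rfl
      rw [pfaffianForm_basisForm] at this
      simpa [cubicForm] using this)
  refine no_plane_of_charP_three hL' fun x hx => ?_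
  simpa [cubicForm] using hzero' x hx

/-- All forms of `W` vanish on the pair `e₀, e₂` of standard basis vectors, so that `e₀ ∧ e₂` is a
point of the dual surface. -/
theorem isZero_dualEquations_single (K : Type*) [Field K] :
    IsZero (dualEquations (basisForm K)) (Pi.single ⟨(0, 2), by decide⟩ 1) := by
  rintro f (hf | ⟨m, rfl⟩)
  · refine (isZero_pluckerQuadrics_iff _).mpr ⟨Pi.single 0 1, Pi.single 2 1, ?_⟩ f hf
    rintro ⟨⟨i, j⟩, hij⟩
    fin_cases i <;> fin_cases j <;> first
      | exact absurd hij (by decide)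
      | simp
  · rw [eval_linearForm]
    simp [Pi.single_apply, basisForm, skewPencil]

end Complexification

end PfaffianCubic

open PfaffianCubic

theorem mainTheorem4 :
    ∃ φ : Fin 6 → Matrix (Fin 6) (Fin 6) ℚ,
      -- a basis `φ` of a six-dimensional rational space `W` of skew-symmetric forms on `V = ℚ⁶`,
      -- whose first five members are a basis of a hyperplane `Z` of `W`
      (∀ m, (φ m).transpose = - φ m) ∧ LinearIndependent ℚ φ ∧
      -- `F = 0` is the Pfaffian cubic fourfold `Y` in `ℙ(W)`,
      -- `f = 0` is the Pfaffian cubic threefold `C` in `ℙ(Z)`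
      ∃ (F : MvPolynomial (Fin 6) ℚ) (f : MvPolynomial (Fin 5) ℚ),
        F = PfaffianCubic.pfaffianForm φ ∧
        f = PfaffianCubic.pfaffianForm (fun m : Fin 5 => φ m.castSucc) ∧
        -- `Y` is the cyclic triple cover of `ℙ(Z)` branched along `C`
        F = PfaffianCubic.cyclicTripleCover f ∧
        -- `C` and `Y` are smooth, and `Y` contains no plane
        PfaffianCubic.IsSmoothOfDim (PfaffianCubic.complexify {f}) 3 ∧
        PfaffianCubic.IsSmoothOfDim (PfaffianCubic.complexify {F}) 4 ∧
        ¬ PfaffianCubic.ContainsLinearSubspace (PfaffianCubic.complexify {F}) 2 ∧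
        -- the dual surface `G(2, V) ∩ ℙ(W°)` is nonempty, smooth, and contains no line
        (∃ x, x ≠ 0 ∧
          PfaffianCubic.IsZero (PfaffianCubic.complexify (PfaffianCubic.dualEquations φ)) x) ∧
        PfaffianCubic.IsSmoothOfDim
          (PfaffianCubic.complexify (PfaffianCubic.dualEquations φ)) 2 ∧
        ¬ PfaffianCubic.ContainsLinearSubspace
          (PfaffianCubic.complexify (PfaffianCubic.dualEquations φ)) 1 := by
  have hY : ∀ c : Fin 6 → ℂ, c ≠ 0 → MvPolynomial.eval c (pfaffianForm (basisForm ℂ)) = 0 →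
      gradient (pfaffianForm (basisForm ℂ)) c ≠ 0 :=
    fun c hc _ => gradient_pfaffianForm_basisForm_ne_zero hc
  have hskew : ∀ m i j, basisForm ℂ m j i = -basisForm ℂ m i j := fun m => skewPencil_swap _
  refine ⟨basisForm ℚ, fun m => Matrix.ext fun i j => skewPencil_swap _ i j,
    linearIndependent_basisForm, _, _, rfl, rfl, ?_⟩
  simp only [complexify_pfaffianForm, complexify_dualEquations, map_basisForm]
  refine ⟨?_, ?_, isSmoothOfDim_singleton (by simp) hY,
    not_containsLinearSubspace_pfaffianForm ℂ, ⟨_, ?_, isZero_dualEquations_single ℂ⟩,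
    isSmoothOfDim_dualEquations hskew hY,
    fun h => not_containsLinearSubspace_pfaffianForm ℂ
      (containsLinearSubspace_pfaffianForm hskew h)⟩
  · rw [pfaffianForm_basisForm, pfaffianForm_basisForm_castSucc, cyclicTripleCover]
    simp [cubicForm]
  · rw [pfaffianForm_basisForm_castSucc]
    refine isSmoothOfDim_singleton (by simp) fun x hx _ h => hx ?_
    rw [gradient_cubicForm] at h
    exact eq_zero_of_cubicGradient_eq_zero h
  · simp
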